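/- Theorem (large sample distribution of the least squares estimator, heteroskedastic case). Let $\beta \in \mathbb{R}^p$ and let $(y, x)$ be a pair of a real random variable $y$ and a random vector $x$ in $\mathbb{R}^p$. Write $y = x^\top \beta + \epsilon$. For each sample size $n$ let $(y_{n,i}, x_{n,i})$, $1 \le i \le n$, be independent copies of $(y, x)$ (for example, the first $n$ terms of one iid sequence). Let $X_n$ be the $n \times p$ design matrix with rows $x_{n,i}^\top$, and let $y_n = (y_{n,1}, \dots, y_{n,n})^\top = X_n \beta + \epsilon_n$. Let $$\hat\beta_n = (X_n^\top X_n)^{-1} X_n^\top y_n$$ be the least squares estimator, where $(X_n^\top X_n)^{-1}$ is read as $0$ on the event that $X_n^\top X_n$ is singular. Assume that 1. the matrix $A = \mathbb{E}[x x^\top]$ has rank $p$; 2. $\mathbb{E}[\epsilon x] = 0$; 3. $\mathbb{E}[\epsilon^4] < \infty$ and $\mathbb{E}[\|x\|^4] < \infty$. Then $\Omega = \mathbb{E}[\epsilon^2 x x^\top]$ exists (its entries are expectations of integrable random variables), the matrix $V = A^{-1} \Omega A^{-1}$ is positive semidefinite, and, as $n \to \infty$, $$\sqrt{n}\,(\hat\beta_n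 - \beta) \xrightarrow{d} \mathcal{N}(0, V).$$ -/

import Mathlib

open MeasureTheory ProbabilityTheory Filter Matrix

noncomputable section

/-- The least squares estimator `(Xᵀ X)⁻¹ Xᵀ y`. (Mathlib's matrix inverse is `0` at a singular
matrix, so the estimator is `0` on the event that `Xᵀ X` is singular.) -/
def olsEstimator {n p : ℕ} (X : Matrix (Fin n) (Fin p) ℝ) (y : Fin n → ℝ) :
    EuclideanSpace ℝ (Fin p) :=
  WithLp.toLp 2 (((Xᵀ * X)⁻¹ * Xᵀ) *ᵥ y)

/-- The matrix `E[x xᵀ]`, computed entrywise. -/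
def secondMomentMatrix {S : Type*} [MeasurableSpace S] {p : ℕ} (P : Measure S)
    (x : S → EuclideanSpace ℝ (Fin p)) : Matrix (Fin p) (Fin p) ℝ :=
  Matrix.of fun j k => ∫ ω, x ω j * x ω k ∂P

/-- The matrix `E[ε² x xᵀ]`, computed entrywise. -/
def scoreMatrix {S : Type*} [MeasurableSpace S] {p : ℕ} (P : Measure S)
    (ε : S → ℝ) (x : S → EuclideanSpace ℝ (Fin p)) : Matrix (Fin p) (Fin p) ℝ :=
  Matrix.of fun j k => ∫ ω, ε ω ^ 2 * (x ω j * x ω k) ∂P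

/-- The asymptotic covariance `V = A⁻¹ Ω A⁻¹` with `A = E[x xᵀ]` and `Ω = E[ε² x xᵀ]`. -/
def asymptoticCovariance {S : Type*} [MeasurableSpace S] {p : ℕ} (P : Measure S)
    (ε : S → ℝ) (x : S → EuclideanSpace ℝ (Fin p)) : Matrix (Fin p) (Fin p) ℝ :=
  (secondMomentMatrix P x)⁻¹ * scoreMatrix P ε x * (secondMomentMatrix P x)⁻¹

end

open scoped RealInnerProductSpace Topology

/-! With `M_n = n⁻¹ XᵀX`, the normalised error splits exactly as `M_n⁻¹ (n^{-1/2} ∑ ε_i x_i) + R_n`,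
where `R_n = √n (M_n⁻¹ M_n β - β)` (`sqrt_smul_olsEstimator_sub`). The scores `ε_i x_i` are centered
and, by the fourth moments, square integrable, so their normalised sum tends to `N(0, Ω)`. The
strong law gives `M_n → A` almost surely; `A` is invertible, so `M_n⁻¹ → A⁻¹` and `R_n` is
eventually zero. Slutsky's theorem yields the limit `A⁻¹ N(0, Ω) = N(0, V)`.

The strong law needs one probability space, while the samples may live on a different space for each
`n`. The argument therefore runs on an infinite product and is transferred by equality of laws
(`TendstoInDistribution.of_infinitePi`). -/

/-! ### Vector central limit theorem and linear images of Gaussians. -/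

lemma charFun_map_inner_one {Ω E : Type*} [MeasurableSpace Ω] [NormedAddCommGroup E]
    [InnerProductSpace ℝ E] [MeasurableSpace E] [BorelSpace E] [SecondCountableTopology E]
    {μ : Measure Ω} {f : Ω → E} (hf : AEMeasurable f μ) (t : E) :
    charFun (μ.map fun ω => ⟪f ω, t⟫) 1 = charFun (μ.map f) t := by
  rw [charFun_apply, charFun_apply, integral_map (by fun_prop) (by fun_prop),
    integral_map hf (by fun_prop)]
  simp

/-- The central limit theorem for centered random vectors. -/
theorem tendstoInDistribution_inv_sqrt_smul_sum {p : ℕ} {Ω : Type*} [MeasurableSpace Ω]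
    {Q : Measure Ω} [IsProbabilityMeasure Q] {W : ℕ → Ω → EuclideanSpace ℝ (Fin p)}
    {C : Matrix (Fin p) (Fin p) ℝ} (hindep : iIndepFun W Q)
    (hident : ∀ i, IdentDistrib (W i) (W 0) Q Q) (hL2 : MemLp (W 0) 2 Q)
    (hmean : ∫ ω, W 0 ω ∂Q = 0) (hC : C.PosSemidef)
    (hcov : ∀ t : EuclideanSpace ℝ (Fin p), ∫ ω, ⟪W 0 ω, t⟫ ^ 2 ∂Q = t ⬝ᵥ C *ᵥ t) :
    TendstoInDistribution (fun (n : ℕ) ω => (√(n : ℝ))⁻¹ • ∑ k ∈ Finset.range n, W k ω) atTop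
      id (fun _ => Q) (multivariateGaussian 0 C) where
  forall_aemeasurable n := by
    have hW i := (hident i).aemeasurable_fst
    fun_prop
  tendsto := by
    have hW i := (hident i).aemeasurable_fst
    refine ProbabilityMeasure.tendsto_iff_tendsto_charFun.2 fun t => ?_
    have hmean_t : ∫ ω, ⟪W 0 ω, t⟫ ∂Q = 0 := by
      simp_rw [real_inner_comm t]
      rw [integral_inner (hL2.integrable (by norm_num)) t, hmean, inner_zero_right]
    have hvar : Var[fun ω => ⟪W 0 ω, t⟫; Q] = t ⬝ᵥ C *ᵥ t := by
      rw [variance_of_integral_eq_zero (by fun_prop) hmean_t, ← hcov t]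
    have hnonneg : 0 ≤ t ⬝ᵥ C *ᵥ t := by
      rw [← hvar]
      exact variance_nonneg _ _
    -- Cramér–Wold: the characteristic function at `t` is that of the projection along `t` at `1`,
    -- so the scalar theorem suffices.
    have hclt := tendstoInDistribution_inv_sqrt_mul_sum_sub (P := Q)
      (P' := gaussianReal 0 Var[fun ω => ⟪W 0 ω, t⟫; Q].toNNReal) (Y := id)
      (X := fun k ω => ⟪W k ω, t⟫) HasLaw.id (hL2.inner_const t)
      (hindep.comp (fun _ w => ⟪w, t⟫) (by fun_prop))
      (fun i => (hident i).comp (u := fun w => ⟪w, t⟫) (by fun_prop))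
    have hlim := ProbabilityMeasure.tendsto_iff_tendsto_charFun.1 hclt.tendsto 1
    simp only [ProbabilityMeasure.coe_mk, Measure.map_id] at hlim ⊢
    rw [charFun_gaussianReal, hvar] at hlim
    rw [charFun_multivariateGaussian hC]
    convert hlim using 2
    · rename_i n
      rw [← charFun_map_inner_one (by fun_prop)]
      congr 2
      ext ω
      simp [hmean_t, inner_smul_left, sum_inner]
    · simp [Real.coe_toNNReal _ hnonneg]

/-- On characteristic functions, pushing forward by `B` replaces `t` by `Bᵀ t`. -/
lemma multivariateGaussian_map_toEuclideanCLM {p : ℕ} {C : Matrix (Fin p) (Fin p) ℝ}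
    (hC : C.PosSemidef) (B : Matrix (Fin p) (Fin p) ℝ) :
    (multivariateGaussian 0 C).map (toEuclideanCLM (𝕜 := ℝ) B) =
      multivariateGaussian 0 (B * C * Bᵀ) := by
  have hBC : (B * C * Bᵀ).PosSemidef := by
    simpa using hC.mul_mul_conjTranspose_same B
  refine Measure.ext_of_charFun (funext fun t => ?_)
  have hmap : charFun ((multivariateGaussian 0 C).map (toEuclideanCLM (𝕜 := ℝ) B)) t =
      charFun (multivariateGaussian 0 C) (toEuclideanCLM (𝕜 := ℝ) Bᵀ t) := by
    rw [charFun_apply, charFun_apply, integral_map (by fun_prop) (by fun_prop)]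
    congr! 5 with z
    rw [real_inner_comm, inner_toEuclideanCLM, inner_toEuclideanCLM, dotProduct_mulVec,
      mulVec_transpose, dotProduct_comm]
  rw [hmap, charFun_multivariateGaussian hC, charFun_multivariateGaussian hBC]
  simp only [inner_zero_right, ofLp_toEuclideanCLM]
  congr 4
  simp only [← mulVec_mulVec, dotProduct_mulVec, mulVec_transpose, vecMul_vecMul]

/-! ### Algebra and measurability of the estimator. -/

/-- No invertibility is needed: the second summand absorbs the failure of `M⁻¹ M = 1` on the
singular event. -/
lemma sqrt_smul_olsEstimator_sub {n p : ℕ} (X : Matrix (Fin n) (Fin p) ℝ)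
    (β : EuclideanSpace ℝ (Fin p)) (e : Fin n → ℝ) :
    √(n : ℝ) • (olsEstimator X (X *ᵥ β + e) - β) =
      WithLp.toLp 2 (((n : ℝ)⁻¹ • (Xᵀ * X))⁻¹ *ᵥ ((√(n : ℝ))⁻¹ • (Xᵀ *ᵥ e))) +
      √(n : ℝ) • (WithLp.toLp 2
        ((((n : ℝ)⁻¹ • (Xᵀ * X))⁻¹ * ((n : ℝ)⁻¹ • (Xᵀ * X))) *ᵥ β) - β) := by
  rcases Nat.eq_zero_or_pos n with rfl | hn
  · simp
  have hn' : (n : ℝ) ≠ 0 := by positivity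
  -- In the singular case both inverses are `0`.
  have hinv : ((n : ℝ)⁻¹ • (Xᵀ * X))⁻¹ = (n : ℝ) • (Xᵀ * X)⁻¹ := by
    by_cases h : IsUnit (Xᵀ * X).det
    · have := invertibleOfNonzero (inv_ne_zero hn')
      rw [Matrix.inv_smul _ _ h]
      simp
    · rw [nonsing_inv_apply_not_isUnit _ h, nonsing_inv_apply_not_isUnit, smul_zero]
      rw [det_smul, isUnit_iff_ne_zero, not_not]
      rw [isUnit_iff_ne_zero, not_not] at h
      simp [h]
  have hsq : (n : ℝ) * (√(n : ℝ))⁻¹ = √(n : ℝ) := by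
    rw [← div_eq_mul_inv, Real.div_sqrt]
  rw [hinv, Matrix.smul_mul, Matrix.mul_smul, smul_smul, mul_inv_cancel₀ hn', one_smul, smul_mulVec,
    mulVec_smul, smul_smul, hsq, olsEstimator, mulVec_add, mulVec_mulVec, mulVec_mulVec,
    Matrix.mul_assoc]
  ext j
  simp only [PiLp.add_apply, PiLp.sub_apply, PiLp.smul_apply, Pi.add_apply, Pi.smul_apply,
    smul_eq_mul]
  ring

lemma isUnit_det_of_rank_eq {p : ℕ} {A : Matrix (Fin p) (Fin p) ℝ} (h : A.rank = p) :
    IsUnit A.det := by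
  rw [← isUnit_iff_isUnit_det, ← mulVec_surjective_iff_isUnit]
  have hrange : A.mulVecLin.range = ⊤ := Submodule.eq_top_of_finrank_eq ?_
  · exact LinearMap.range_eq_top.1 hrange
  simpa [Matrix.rank] using h

/-- Inversion is discontinuous at singular matrices, but it is adjugate times inverse determinant,
and scalar inversion with `0⁻¹ = 0` is measurable. -/
lemma measurable_matrix_inv_apply {p : ℕ} {α : Type*} [MeasurableSpace α]
    {M : α → Matrix (Fin p) (Fin p) ℝ} (hM : ∀ i j, Measurable fun a => M a i j) (i j : Fin p) :
    Measurable fun a => (M a)⁻¹ i j := by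
  have hM' : Measurable fun a k l => M a k l :=
    measurable_pi_iff.2 fun k => measurable_pi_iff.2 (hM k)
  have h1 : Continuous fun N : Fin p → Fin p → ℝ => (of N).det :=
    Continuous.matrix_det continuous_id
  have h2 : Continuous fun N : Fin p → Fin p → ℝ => (of N).adjugate i j :=
    (Continuous.matrix_adjugate continuous_id).matrix_elem i j
  simp only [inv_def, Ring.inverse_eq_inv', Matrix.smul_apply, smul_eq_mul]
  exact (h1.measurable.comp hM').inv.mul (h2.measurable.comp hM')

lemma measurable_olsEstimator {n p : ℕ} {α : Type*} [MeasurableSpace α]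
    {X : α → Matrix (Fin n) (Fin p) ℝ} {y : α → Fin n → ℝ}
    (hX : ∀ i j, Measurable fun a => X a i j) (hy : ∀ i, Measurable fun a => y a i) :
    Measurable fun a => olsEstimator (X a) (y a) := by
  have hinv : ∀ k l, Measurable fun a => ((X a)ᵀ * X a)⁻¹ k l :=
    measurable_matrix_inv_apply fun k l => by
      simp only [mul_apply, transpose_apply]
      exact Finset.measurable_sum _ fun i _ => (hX i k).mul (hX i l)
  have hmul : Measurable fun a => (((X a)ᵀ * X a)⁻¹ * (X a)ᵀ) *ᵥ y a := by
    have hB j i : Measurable fun a => (((X a)ᵀ * X a)⁻¹ * (X a)ᵀ) j i := by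
      have h a : (((X a)ᵀ * X a)⁻¹ * (X a)ᵀ) j i = ∑ k, ((X a)ᵀ * X a)⁻¹ j k * X a i k := rfl
      simp_rw [h]
      exact Finset.measurable_sum _ fun k _ => (hinv j k).mul (hX i k)
    refine measurable_pi_iff.2 fun j => ?_
    simp only [mulVec, dotProduct]
    exact Finset.measurable_sum _ fun i _ => (hB j i).mul (hy i)
  exact (PiLp.continuous_toLp 2 _).measurable.comp hmul

/-! ### Moment bounds and the matrices `A`, `Ω`, `V`. -/

section Moments

variable {p : ℕ} {S : Type*} [MeasurableSpace S] {P : Measure S}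
  {x : S → EuclideanSpace ℝ (Fin p)} {ε : S → ℝ}

lemma abs_apply_mul_apply_le (v : EuclideanSpace ℝ (Fin p)) (j k : Fin p) :
    |v j * v k| ≤ ‖v‖ ^ 2 := by
  rw [abs_mul, sq]
  exact mul_le_mul (PiLp.norm_apply_le v j) (PiLp.norm_apply_le v k) (abs_nonneg _) (norm_nonneg _)

lemma integrable_apply_mul_apply [IsFiniteMeasure P] (hxm : AEMeasurable x P)
    (hx : Integrable (fun s => ‖x s‖ ^ 4) P) (j k : Fin p) :
    Integrable (fun s => x s j * x s k) P := by
  refine ((integrable_const 1).add hx).mono' (by fun_prop) (ae_of_all _ fun s => ?_)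
  refine (abs_apply_mul_apply_le (x s) j k).trans ?_
  simp only [Pi.add_apply]
  nlinarith [sq_nonneg (‖x s‖ ^ 2 - 1)]

lemma integrable_sq_mul_sq_norm (hεm : AEMeasurable ε P) (hxm : AEMeasurable x P)
    (hε : Integrable (fun s => ε s ^ 4) P) (hx : Integrable (fun s => ‖x s‖ ^ 4) P) :
    Integrable (fun s => ε s ^ 2 * ‖x s‖ ^ 2) P := by
  refine (hε.add hx).mono' (by fun_prop) (ae_of_all _ fun s => ?_)
  rw [Real.norm_of_nonneg (by positivity)]
  simp only [Pi.add_apply]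
  nlinarith [sq_nonneg (ε s ^ 2 - ‖x s‖ ^ 2), sq_nonneg (ε s ^ 2), sq_nonneg (‖x s‖ ^ 2)]

lemma integrable_sq_mul_apply_mul_apply (hεm : AEMeasurable ε P) (hxm : AEMeasurable x P)
    (hε : Integrable (fun s => ε s ^ 4) P) (hx : Integrable (fun s => ‖x s‖ ^ 4) P)
    (j k : Fin p) : Integrable (fun s => ε s ^ 2 * (x s j * x s k)) P := by
  refine (integrable_sq_mul_sq_norm hεm hxm hε hx).mono' (by fun_prop) (ae_of_all _ fun s => ?_)
  rw [norm_mul, Real.norm_of_nonneg (sq_nonneg _)]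
  exact mul_le_mul_of_nonneg_left (abs_apply_mul_apply_le (x s) j k) (sq_nonneg _)

lemma memLp_two_smul (hεm : AEMeasurable ε P) (hxm : AEMeasurable x P)
    (hε : Integrable (fun s => ε s ^ 4) P) (hx : Integrable (fun s => ‖x s‖ ^ 4) P) :
    MemLp (fun s => ε s • x s) 2 P := by
  rw [memLp_two_iff_integrable_sq_norm (by fun_prop)]
  simpa [norm_smul, mul_pow] using integrable_sq_mul_sq_norm hεm hxm hε hx

/-- Serves twice: for positivity of `Ω`, and to identify the limiting covariance of the scores. -/
lemma integral_inner_smul_sq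
    (hint : ∀ j k, Integrable (fun s => ε s ^ 2 * (x s j * x s k)) P)
    (t : EuclideanSpace ℝ (Fin p)) :
    ∫ s, ⟪ε s • x s, t⟫ ^ 2 ∂P = t ⬝ᵥ scoreMatrix P ε x *ᵥ t := by
  have hexp s : ⟪ε s • x s, t⟫ ^ 2 =
      ∑ j, ∑ k, t j * (ε s ^ 2 * (x s j * x s k) * t k) := by
    rw [inner_smul_left, PiLp.inner_apply, mul_pow, sq (∑ j, _), Finset.sum_mul_sum,
      Finset.mul_sum]
    refine Finset.sum_congr rfl fun j _ => ?_
    rw [Finset.mul_sum]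
    refine Finset.sum_congr rfl fun k _ => ?_
    simp
    ring
  simp_rw [hexp]
  rw [integral_finsetSum _ fun j _ => integrable_finsetSum _ fun k _ =>
    ((hint j k).mul_const _).const_mul _]
  refine Finset.sum_congr rfl fun j _ => ?_
  rw [integral_finsetSum _ fun k _ => ((hint j k).mul_const _).const_mul _, mulVec, dotProduct,
    Finset.mul_sum]
  refine Finset.sum_congr rfl fun k _ => ?_
  rw [integral_const_mul, integral_mul_const]
  rfl

lemma posSemidef_scoreMatrix
    (hint : ∀ j k, Integrable (fun s => ε s ^ 2 * (x s j * x s k)) P) :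
    (scoreMatrix P ε x).PosSemidef := by
  refine PosSemidef.of_dotProduct_mulVec_nonneg ?_ fun t => ?_
  · ext j k
    simp [scoreMatrix, mul_comm]
  · have h := integral_inner_smul_sq hint (WithLp.toLp 2 t)
    simp only [star_trivial]
    rw [← h]
    exact integral_nonneg fun s => sq_nonneg _

lemma transpose_secondMomentMatrix : (secondMomentMatrix P x)ᵀ = secondMomentMatrix P x := by
  ext j k
  simp [secondMomentMatrix, mul_comm]

/-- Symmetry of `A` gives the form `B Ω Bᵀ`, suited to positivity and to Gaussian images. -/
lemma asymptoticCovariance_eq :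
    asymptoticCovariance P ε x =
      (secondMomentMatrix P x)⁻¹ * scoreMatrix P ε x * ((secondMomentMatrix P x)⁻¹)ᵀ := by
  rw [transpose_nonsing_inv, transpose_secondMomentMatrix, asymptoticCovariance]

lemma posSemidef_asymptoticCovariance
    (hint : ∀ j k, Integrable (fun s => ε s ^ 2 * (x s j * x s k)) P) :
    (asymptoticCovariance P ε x).PosSemidef := by
  rw [asymptoticCovariance_eq]
  simpa using (posSemidef_scoreMatrix hint).mul_mul_conjTranspose_same (secondMomentMatrix P x)⁻¹

end Moments

/-! ### Asymptotic normality on a single probability space. -/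

lemma MeasureTheory.TendstoInDistribution.congr_map {E ι Ω₁' Ω₂' : Type*} {Ω₁ Ω₂ : ι → Type*}
    [TopologicalSpace E] [MeasurableSpace E] [OpensMeasurableSpace E]
    [∀ i, MeasurableSpace (Ω₁ i)] [∀ i, MeasurableSpace (Ω₂ i)] [MeasurableSpace Ω₁']
    [MeasurableSpace Ω₂'] {μ₁ : (i : ι) → Measure (Ω₁ i)} {μ₂ : (i : ι) → Measure (Ω₂ i)}
    [∀ i, IsProbabilityMeasure (μ₁ i)] [∀ i, IsProbabilityMeasure (μ₂ i)]
    {ν₁ : Measure Ω₁'} {ν₂ : Measure Ω₂'} [IsProbabilityMeasure ν₁] [IsProbabilityMeasure ν₂]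
    {X₁ : (i : ι) → Ω₁ i → E} {X₂ : (i : ι) → Ω₂ i → E} {Z₁ : Ω₁' → E} {Z₂ : Ω₂' → E}
    {l : Filter ι} (h : TendstoInDistribution X₁ l Z₁ μ₁ ν₁)
    (hX₂ : ∀ i, AEMeasurable (X₂ i) (μ₂ i)) (hZ₂ : AEMeasurable Z₂ ν₂)
    (hX : ∀ i, (μ₂ i).map (X₂ i) = (μ₁ i).map (X₁ i)) (hZ : ν₂.map Z₂ = ν₁.map Z₁) :
    TendstoInDistribution X₂ l Z₂ μ₂ ν₂ where
  forall_aemeasurable := hX₂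
  aemeasurable_limit := hZ₂
  tendsto := by
    simp only [hX, hZ]
    exact h.tendsto

/-- Asymptotic normality of least squares along a single sequence of independent copies. -/
theorem tendstoInDistribution_olsEstimator_seq {p : ℕ} (β : EuclideanSpace ℝ (Fin p))
    {S : Type*} [MeasurableSpace S] {P : Measure S} [IsProbabilityMeasure P]
    {x : S → EuclideanSpace ℝ (Fin p)} {y ε : S → ℝ} (hmodel : ∀ s, y s = x s ⬝ᵥ β + ε s)
    (hεm : AEMeasurable ε P) (hxm : AEMeasurable x P)
    (hrank : (secondMomentMatrix P x).rank = p) (horth : ∫ s, ε s • x s ∂P = 0)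
    (hε : Integrable (fun s => ε s ^ 4) P) (hx : Integrable (fun s => ‖x s‖ ^ 4) P)
    {Ω : Type*} [MeasurableSpace Ω] {Q : Measure Ω} [IsProbabilityMeasure Q]
    {u : ℕ → Ω → ℝ × EuclideanSpace ℝ (Fin p)} (hu : ∀ i, Measurable (u i))
    (hindep : iIndepFun u Q) (hident : ∀ i, IdentDistrib (u i) (fun s => (y s, x s)) Q P) :
    TendstoInDistribution
      (fun (n : ℕ) ω => √(n : ℝ) • (olsEstimator
        (Matrix.of fun (i : Fin n) j => (u i ω).2 j) (fun i : Fin n => (u i ω).1) - β)) atTop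
      id (fun _ => Q) (multivariateGaussian 0 (asymptoticCovariance P ε x)) := by
  set A := secondMomentMatrix P x with hA
  have hAdet : IsUnit A.det := isUnit_det_of_rank_eq hrank
  have hint := integrable_sq_mul_apply_mul_apply hεm hxm hε hx
  have hΩ := posSemidef_scoreMatrix hint
  -- The score as a function of the observed pair, so that independence and common law pass to the
  -- scores.
  let h : ℝ × EuclideanSpace ℝ (Fin p) → EuclideanSpace ℝ (Fin p) :=
    fun q => (q.1 - q.2 ⬝ᵥ β) • q.2
  have hh : Measurable h := by
    have : Continuous h := by
      simp only [h, dotProduct]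
      fun_prop
    exact this.measurable
  let W : ℕ → Ω → EuclideanSpace ℝ (Fin p) := fun i ω => h (u i ω)
  have hWident i : IdentDistrib (W i) (fun s => ε s • x s) Q P := by
    have hres : h ∘ (fun s => (y s, x s)) = fun s => ε s • x s := by
      ext s : 1
      simp [h, hmodel]
    rw [← hres]
    exact (hident i).comp hh
  have hclt : TendstoInDistribution (fun (n : ℕ) ω => (√(n : ℝ))⁻¹ • ∑ k ∈ Finset.range n, W k ω)
      atTop id (fun _ => Q) (multivariateGaussian 0 (scoreMatrix P ε x)) := by
    refine tendstoInDistribution_inv_sqrt_smul_sum (hindep.comp (fun _ => h) fun _ => hh)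
      (fun i => (hWident i).trans (hWident 0).symm)
      ((hWident 0).memLp_iff.2 (memLp_two_smul hεm hxm hε hx))
      ((hWident 0).integral_eq.trans horth) hΩ fun t => ?_
    rw [← integral_inner_smul_sq hint]
    exact ((hWident 0).comp (u := fun w => ⟪w, t⟫ ^ 2) (by fun_prop)).integral_eq
  let M : ℕ → Ω → Matrix (Fin p) (Fin p) ℝ := fun n ω =>
    Matrix.of fun j k => (n : ℝ)⁻¹ • ∑ i ∈ Finset.range n, (u i ω).2 j * (u i ω).2 k
  have hMmeas n j k : Measurable fun ω => M n ω j k := by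
    simp only [M, of_apply]
    fun_prop
  have hMlim : ∀ᵐ ω ∂Q, Tendsto (fun n => M n ω) atTop (𝓝 A) := by
    have hjk : ∀ j k, ∀ᵐ ω ∂Q, Tendsto (fun n => M n ω j k) atTop (𝓝 (A j k)) := by
      intro j k
      have hg : Measurable fun q : ℝ × EuclideanSpace ℝ (Fin p) => q.2 j * q.2 k := by fun_prop
      have hid i := (hident i).comp hg
      have hI := (hid 0).integral_eq
      have := strong_law_ae (fun i ω => (u i ω).2 j * (u i ω).2 k)
        ((hid 0).integrable_iff.2 (integrable_apply_mul_apply hxm hx j k))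
        (fun a b hab => (hindep.indepFun hab).comp hg hg)
        (fun i => (hid i).trans (hid 0).symm)
      filter_upwards [this] with ω hω
      have hA' : A j k = ∫ ω, (u 0 ω).2 j * (u 0 ω).2 k ∂Q := hI.symm
      rw [hA']
      exact hω
    filter_upwards [ae_all_iff.2 fun j => ae_all_iff.2 (hjk j)] with ω hω
    exact tendsto_pi_nhds.2 fun j => tendsto_pi_nhds.2 (hω j)
  have hinvlim : ∀ᵐ ω ∂Q, Tendsto (fun n j k => (M n ω)⁻¹ j k) atTop (𝓝 fun j k => A⁻¹ j k) := by
    have hcont : ContinuousAt (fun B : Matrix (Fin p) (Fin p) ℝ => B⁻¹) A :=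
      continuousAt_matrix_inv A
        (by simpa [Ring.inverse_eq_inv'] using continuousAt_inv₀ hAdet.ne_zero)
    filter_upwards [hMlim] with ω hω using hcont.tendsto.comp hω
  let R : ℕ → Ω → EuclideanSpace ℝ (Fin p) := fun n ω =>
    √(n : ℝ) • (WithLp.toLp 2 (((M n ω)⁻¹ * M n ω) *ᵥ β) - β)
  have hinvmeas n : Measurable fun ω j k => (M n ω)⁻¹ j k :=
    measurable_pi_iff.2 fun j => measurable_pi_iff.2 (measurable_matrix_inv_apply (hMmeas n) j)
  have hRmeas n : Measurable (R n) := by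
    have h1 j k : Measurable fun ω => (M n ω)⁻¹ j k := measurable_matrix_inv_apply (hMmeas n) j k
    have h2 : Measurable fun ω => ((M n ω)⁻¹ * M n ω) *ᵥ β := by
      refine measurable_pi_iff.2 fun j => ?_
      simp only [mulVec, dotProduct, mul_apply]
      fun_prop
    have h3 : Measurable fun ω => WithLp.toLp 2 (((M n ω)⁻¹ * M n ω) *ᵥ β) - β :=
      ((PiLp.continuous_toLp 2 _).measurable.comp h2).sub_const _
    exact h3.const_smul √(n : ℝ)
  have hRlim : ∀ᵐ ω ∂Q, Tendsto (fun n => R n ω) atTop (𝓝 0) := by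
    filter_upwards [hMlim] with ω hω
    have hdet : Tendsto (fun n => (M n ω).det) atTop (𝓝 A.det) :=
      ((continuous_id.matrix_det).tendsto A).comp hω
    -- The factor `√n` is harmless: once `det M_n ≠ 0` the remainder is exactly zero.
    refine tendsto_const_nhds.congr' ?_
    filter_upwards [hdet.eventually_ne hAdet.ne_zero] with n hn
    simp [R, nonsing_inv_mul _ (isUnit_iff_ne_zero.2 hn)]
  -- Slutsky for the continuous map (vector, matrix) ↦ matrix times vector, with `M_n⁻¹` tending to
  -- a constant.
  have hslutsky := TendstoInDistribution.continuous_comp_prodMk_of_tendstoInMeasure_const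
    (E := EuclideanSpace ℝ (Fin p)) (E' := Fin p → Fin p → ℝ) (F := EuclideanSpace ℝ (Fin p))
    (μ'' := Q) (μ' := multivariateGaussian 0 (scoreMatrix P ε x)) (Z := id)
    (X := fun (n : ℕ) ω => (√(n : ℝ))⁻¹ • ∑ k ∈ Finset.range n, W k ω)
    (Y := fun n ω j k => (M n ω)⁻¹ j k)
    (g := fun q => WithLp.toLp 2 ((Matrix.of q.2) *ᵥ WithLp.ofLp q.1))
    (by
      have : Continuous fun q : EuclideanSpace ℝ (Fin p) × (Fin p → Fin p → ℝ) =>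
          (Matrix.of q.2) *ᵥ (WithLp.ofLp q.1) :=
        Continuous.matrix_mulVec continuous_snd (by fun_prop)
      fun_prop) hclt
    (tendstoInMeasure_of_tendsto_ae (fun n => (hinvmeas n).aestronglyMeasurable) hinvlim)
    (fun n => (hinvmeas n).aemeasurable)
  have hsum := hslutsky.add_of_tendstoInMeasure_const
    (tendstoInMeasure_of_tendsto_ae (fun n => (hRmeas n).aestronglyMeasurable) hRlim)
    (fun n => (hRmeas n).aemeasurable)
  have hdecomp (n : ℕ) (ω : Ω) : √(n : ℝ) • (olsEstimator
      (Matrix.of fun (i : Fin n) j => (u i ω).2 j) (fun i : Fin n => (u i ω).1) - β) =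
      WithLp.toLp 2 ((Matrix.of fun j k => (M n ω)⁻¹ j k) *ᵥ
        WithLp.ofLp ((√(n : ℝ))⁻¹ • ∑ k ∈ Finset.range n, W k ω)) + R n ω := by
    set X : Matrix (Fin n) (Fin p) ℝ := Matrix.of fun (i : Fin n) j => (u i ω).2 j with hX
    have hM : M n ω = (n : ℝ)⁻¹ • (Xᵀ * X) := by
      ext j k
      simp [M, X, mul_apply, Finset.sum_range]
    have hW : WithLp.ofLp (∑ k ∈ Finset.range n, W k ω) =
        Xᵀ *ᵥ fun i : Fin n => (u i ω).1 - (u i ω).2 ⬝ᵥ β := by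
      ext j
      simp [W, h, X, mulVec, dotProduct, Finset.sum_range, mul_comm]
    have hy : (fun i : Fin n => (u i ω).1) =
        X *ᵥ β + fun i : Fin n => (u i ω).1 - (u i ω).2 ⬝ᵥ β := by
      ext i
      simp [X, mulVec]
    rw [hy, sqrt_smul_olsEstimator_sub, WithLp.ofLp_smul, hW]
    simp only [R, hM]
    rfl
  have hlaw : (multivariateGaussian 0 (scoreMatrix P ε x)).map
      (fun z => WithLp.toLp 2 ((Matrix.of fun j k => A⁻¹ j k) *ᵥ WithLp.ofLp (id z)) + 0) =
      multivariateGaussian 0 (asymptoticCovariance P ε x) := by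
    rw [asymptoticCovariance_eq, ← multivariateGaussian_map_toEuclideanCLM hΩ]
    congr 1
    ext z : 1
    simp
    rfl
  refine hsum.congr_map (fun n => ?_) (by fun_prop) (fun n => ?_) ?_
  · simp_rw [hdecomp]
    exact hsum.forall_aemeasurable n
  · simp_rw [hdecomp]
    rfl
  · rw [Measure.map_id]
    exact hlaw.symm

/-! ### Transfer to samples on varying probability spaces. -/

lemma measurable_sqrt_smul_olsEstimator_sub {p : ℕ} (β : EuclideanSpace ℝ (Fin p)) (n : ℕ) :
    Measurable fun q : Fin n → ℝ × EuclideanSpace ℝ (Fin p) => √(n : ℝ) •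
      (olsEstimator (Matrix.of fun i j => (q i).2 j) (fun i => (q i).1) - β) := by
  have h : Measurable fun q : Fin n → ℝ × EuclideanSpace ℝ (Fin p) =>
      olsEstimator (Matrix.of fun i j => (q i).2 j) (fun i => (q i).1) := by
    refine measurable_olsEstimator (fun i j => ?_) fun i => by fun_prop
    simp only [of_apply]
    fun_prop
  exact (h.sub_const β).const_smul √(n : ℝ)

/-- By independence the joint law of the `n` entries is the `n`-fold product of `ν`, which is also
the law of the first `n` coordinates. -/
lemma map_comp_eq_map_infinitePi {n : ℕ} {F E Ω : Type*} [MeasurableSpace F] [MeasurableSpace E]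
    [MeasurableSpace Ω] {μ : Measure Ω} [IsProbabilityMeasure μ] {ν : Measure F}
    [IsProbabilityMeasure ν] {u : Fin n → Ω → F} (hu : ∀ i, AEMeasurable (u i) μ)
    (hindep : iIndepFun u μ) (hlaw : ∀ i, μ.map (u i) = ν) {G : (Fin n → F) → E}
    (hG : Measurable G) :
    μ.map (fun ω => G fun i => u i ω) =
      (Measure.infinitePi fun _ : ℕ => ν).map fun ω => G fun i => ω i := by
  have hjoint : μ.map (fun ω i => u i ω) =
      (Measure.infinitePi fun _ : ℕ => ν).map fun ω (i : Fin n) => ω i := by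
    rw [(iIndepFun_iff_map_fun_eq_pi_map hu).1 hindep,
      Measure.map_infinitePi_infinitePi_of_inj (P := fun _ : ℕ => ν) Fin.val_injective,
      Measure.infinitePi_eq_pi]
    simp_rw [hlaw]
  have h := AEMeasurable.map_map_of_aemeasurable hG.aemeasurable (aemeasurable_pi_iff.2 hu)
  rw [hjoint, Measure.map_map hG (by fun_prop)] at h
  exact h.symm

/-- Convergence in distribution of statistics of independent copies only depends on their law. -/
lemma MeasureTheory.TendstoInDistribution.of_infinitePi {F E Ω' : Type*} [MeasurableSpace F]
    [TopologicalSpace E] [MeasurableSpace E] [OpensMeasurableSpace E] [MeasurableSpace Ω']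
    {Ω : ℕ → Type*} [∀ n, MeasurableSpace (Ω n)] {μ : (n : ℕ) → Measure (Ω n)}
    [∀ n, IsProbabilityMeasure (μ n)] {ν : Measure F} [IsProbabilityMeasure ν]
    {ρ : Measure Ω'} [IsProbabilityMeasure ρ] {Z : Ω' → E} {G : (n : ℕ) → (Fin n → F) → E}
    (h : TendstoInDistribution (fun n (ω : ℕ → F) => G n fun i => ω i) atTop Z
      (fun _ => Measure.infinitePi fun _ : ℕ => ν) ρ)
    (hG : ∀ n, Measurable (G n)) {u : (n : ℕ) → Fin n → Ω n → F}
    (hu : ∀ n i, AEMeasurable (u n i) (μ n)) (hindep : ∀ n, iIndepFun (u n) (μ n))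
    (hlaw : ∀ n i, (μ n).map (u n i) = ν) :
    TendstoInDistribution (fun n ω => G n fun i => u n i ω) atTop Z μ ρ :=
  h.congr_map (fun n => (hG n).comp_aemeasurable (aemeasurable_pi_iff.2 (hu n)))
    h.aemeasurable_limit
    (fun n => map_comp_eq_map_infinitePi (hu n) (hindep n) (hlaw n) (hG n)) rfl

theorem mainTheorem7 {p : ℕ} (β : EuclideanSpace ℝ (Fin p))
    -- the population: `y = xᵀ β + ε`
    {S : Type*} [MeasurableSpace S] (P : Measure S) [IsProbabilityMeasure P]
    (x : S → EuclideanSpace ℝ (Fin p)) (y ε : S → ℝ)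
    (hmodel : ∀ s, y s = x s ⬝ᵥ β + ε s)
    -- the samples: for each sample size `n`, `y_n = X_n β + ε_n`
    {Ω : ℕ → Type*} [∀ n, MeasurableSpace (Ω n)] (μ : (n : ℕ) → Measure (Ω n))
    [∀ n, IsProbabilityMeasure (μ n)]
    (X : (n : ℕ) → Ω n → Matrix (Fin n) (Fin p) ℝ) (Y e : (n : ℕ) → Ω n → Fin n → ℝ)
    (hsample : ∀ n ω, Y n ω = X n ω *ᵥ β + e n ω)
    -- random sampling: the rows are independent copies of the pair `(y, x)`
    (hindep : ∀ n, iIndepFun (fun (i : Fin n) ω =>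
      ((Y n ω i, WithLp.toLp 2 (X n ω i)) : ℝ × EuclideanSpace ℝ (Fin p))) (μ n))
    (hident : ∀ n (i : Fin n), IdentDistrib
      (fun ω => ((Y n ω i, WithLp.toLp 2 (X n ω i)) : ℝ × EuclideanSpace ℝ (Fin p)))
      (fun s => (y s, x s)) (μ n) P)
    -- full rank, orthogonality of the noise, finite fourth moments
    (hrank : (secondMomentMatrix P x).rank = p)
    (horth : ∫ s, ε s • x s ∂P = 0)
    (hε : Integrable (fun s => ε s ^ 4) P)
    (hx : Integrable (fun s => ‖x s‖ ^ 4) P) :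
    (∀ j k, Integrable (fun s => ε s ^ 2 * (x s j * x s k)) P) ∧
    (asymptoticCovariance P ε x).PosSemidef ∧
    TendstoInDistribution
      (fun (n : ℕ) (ω : Ω n) => √(n : ℝ) • (olsEstimator (X n ω) (Y n ω) - β)) atTop
      id μ (multivariateGaussian 0 (asymptoticCovariance P ε x)) := by
  -- Measurability of the population pair comes from the sample of size `1`, the smallest with a
  -- row.
  have hpair : AEMeasurable (fun s => (y s, x s)) P := (hident 1 0).aemeasurable_snd
  have hym : AEMeasurable y P := hpair.fst
  have hxm : AEMeasurable x P := hpair.snd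
  have hεm : AEMeasurable ε P := by
    have hε_eq : ε = fun s => y s - ∑ j, x s j * β j := by
      ext s
      simp [hmodel s, dotProduct]
    rw [hε_eq]
    fun_prop
  have hint := integrable_sq_mul_apply_mul_apply hεm hxm hε hx
  refine ⟨hint, posSemidef_asymptoticCovariance hint, ?_⟩
  set ν := P.map fun s => (y s, x s) with hν
  have : IsProbabilityMeasure ν := Measure.isProbabilityMeasure_map hpair
  have hseq := tendstoInDistribution_olsEstimator_seq β hmodel hεm hxm hrank horth hε hx
    (Q := Measure.infinitePi fun _ : ℕ => ν) (u := fun i ω => ω i) (fun i => measurable_pi_apply i)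
    (iIndepFun_infinitePi (X := fun _ q => q) fun _ => measurable_id)
    (fun i => ⟨(measurable_pi_apply i).aemeasurable, hpair, by rw [Measure.infinitePi_map_eval]⟩)
  have hlim := TendstoInDistribution.of_infinitePi (μ := μ) (ν := ν) (Z := id)
    (ρ := multivariateGaussian 0 (asymptoticCovariance P ε x))
    (G := fun n q => √(n : ℝ) •
      (olsEstimator (Matrix.of fun i j => (q i).2 j) (fun i => (q i).1) - β))
    (u := fun n i ω => (Y n ω i, WithLp.toLp 2 (X n ω i))) hseq
    (measurable_sqrt_smul_olsEstimator_sub β) (fun n i => (hident n i).aemeasurable_fst) hindep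
    fun n i => (hident n i).map_eq
  exact hlim
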